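/- Let $H_1,H_2$ be complex Hilbert spaces, and let $A:\mathcal D(A)\subset H_1\to H_1$, $B:\mathcal D(B)\subset H_2\to H_1$, $C:\mathcal D(C)\subset H_1\to H_2$, $D:\mathcal D(D)\subset H_2\to H_2$ be densely defined closable linear operators with $A\subset A^*$, $B\subset C^*$, $D\subset D^*$. Let $$\mathcal A=\begin{pmatrix}A&B\\C&D\end{pmatrix}$$ be the induced operator on the Hilbert space $H_1\times H_2$ (with norm $\|(x,y)\|=(\|x\|^2+\|y\|^2)^{1/2}$), with domain $\mathcal D(\mathcal A)=(\mathcal D(A)\cap\mathcal D(C))\times(\mathcal D(B)\cap\mathcal D(D))$ and $\mathcal A(x,y)=(Ax+By,\,Cx+Dy)$, and assume that $\mathcal D(\mathcal A)$ is dense. Then $\mathcal A$ is essentially self-adjoint (that is, $\mathcal A$ is closable and its closure is self-adjoint) if one of the following statements holds: (a) $A$ and $D$ are self-adjoint, $\mathcal D(A)\subset\mathcal D(C)$, $\mathcal D(D)\subset\mathcal D(B)$, and for some $a\ge 0$, $$\|Cx\|^2\le a\|x\|^2+\|Ax\|^2\quad (x\in\mathcal D(A)),\qquad \|By\|^2\le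 a\|y\|^2+\|Dy\|^2\quad (y\in\mathcal D(D)).$$ (b) $B$ is closed, $C=B^*$, $\mathcal D(C)\subset\mathcal D(A)$, $\mathcal D(B)\subset\mathcal D(D)$, and for some $a\ge 0$, $$\|Ax\|^2\le a\|x\|^2+\|Cx\|^2\quad (x\in\mathcal D(C)),\qquad \|Dy\|^2\le a\|y\|^2+\|By\|^2\quad (y\in\mathcal D(B)).$$ -/

import Mathlib

/-- The linear operator on the Hilbert space `H₁ ⊕ H₂` (the product with the inner product
`⟪x₁, y₁⟫ + ⟪x₂, y₂⟫`) induced by the block operator matrix `(A B; C D)` of partially defined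
operators. Its domain is `(D(A) ∩ D(C)) × (D(B) ∩ D(D))` and it maps `(x, y)` to
`(A x + B y, C x + D y)`. -/
def blockOperator {H₁ H₂ : Type*}
    [NormedAddCommGroup H₁] [InnerProductSpace ℂ H₁]
    [NormedAddCommGroup H₂] [InnerProductSpace ℂ H₂]
    (A : H₁ →ₗ.[ℂ] H₁) (B : H₂ →ₗ.[ℂ] H₁) (C : H₁ →ₗ.[ℂ] H₂) (D : H₂ →ₗ.[ℂ] H₂) :
    WithLp 2 (H₁ × H₂) →ₗ.[ℂ] WithLp 2 (H₁ × H₂) where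
  domain := ((A.domain ⊓ C.domain).prod (B.domain ⊓ D.domain)).comap
    (WithLp.linearEquiv 2 ℂ (H₁ × H₂)).toLinearMap
  toFun :=
    { toFun := fun z => WithLp.toLp 2
        (A ⟨z.1.fst, z.2.1.1⟩ + B ⟨z.1.snd, z.2.2.1⟩,
          C ⟨z.1.fst, z.2.1.2⟩ + D ⟨z.1.snd, z.2.2.2⟩)
      map_add' := fun z w => by
        have hA := A.map_add ⟨z.1.fst, z.2.1.1⟩ ⟨w.1.fst, w.2.1.1⟩
        have hB := B.map_add ⟨z.1.snd, z.2.2.1⟩ ⟨w.1.snd, w.2.2.1⟩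
        have hC := C.map_add ⟨z.1.fst, z.2.1.2⟩ ⟨w.1.fst, w.2.1.2⟩
        have hD := D.map_add ⟨z.1.snd, z.2.2.2⟩ ⟨w.1.snd, w.2.2.2⟩
        rw [← WithLp.toLp_add, Prod.mk_add_mk, add_add_add_comm, ← hA, ← hB,
          add_add_add_comm, ← hC, ← hD]
        rfl
      map_smul' := fun c z => by
        have hA := A.map_smul c ⟨z.1.fst, z.2.1.1⟩
        have hB := B.map_smul c ⟨z.1.snd, z.2.2.1⟩
        have hC := C.map_smul c ⟨z.1.fst, z.2.1.2⟩
        have hD := D.map_smul c ⟨z.1.snd, z.2.2.2⟩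
        rw [RingHom.id_apply, ← WithLp.toLp_smul, Prod.smul_mk, smul_add, smul_add,
          ← hA, ← hB, ← hC, ← hD]
        rfl }

/-- A densely defined operator in a complex Hilbert space is essentially self-adjoint if it is
closable and its closure is self-adjoint. -/
def IsEssentiallySelfAdjoint {H : Type*}
    [NormedAddCommGroup H] [InnerProductSpace ℂ H] [CompleteSpace H] (T : H →ₗ.[ℂ] H) : Prop :=
  Dense (T.domain : Set H) ∧ T.IsClosable ∧ IsSelfAdjoint T.closure

/-- `D(S) ⊆ D(T)` and `‖T x‖² ≤ a ‖x‖² + ‖S x‖²` for all `x ∈ D(S)`. -/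
def SqRelBounded {E F G : Type*}
    [NormedAddCommGroup E] [InnerProductSpace ℂ E]
    [NormedAddCommGroup F] [InnerProductSpace ℂ F]
    [NormedAddCommGroup G] [InnerProductSpace ℂ G]
    (T : E →ₗ.[ℂ] F) (S : E →ₗ.[ℂ] G) (a : ℝ) : Prop :=
  ∃ h : S.domain ≤ T.domain, ∀ x : S.domain,
    ‖T (Submodule.inclusion h x)‖ ^ 2 ≤ a * ‖(x : E)‖ ^ 2 + ‖S x‖ ^ 2

/-! Split the block operator into its diagonal and off-diagonal parts. In each case one part is
self-adjoint and the other is a symmetric perturbation with relative bound 1, since the two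
componentwise square bounds add up in the Hilbert sum norm. Both cases then follow from Wüst's
theorem, `IsSelfAdjoint.isEssentiallySelfAdjoint_add`.

Wüst's theorem for `S + V`: once `c ^ 2 ≥ a`, the bound reads `‖V x‖ ≤ ‖(S + i c) x‖`. For `t < 1` a
Neumann series makes `S + t V + i c` onto, and letting `t → 1` shows that nothing nonzero is
orthogonal to the range of `S + V + i c`. The same holds for `-c`, so both deficiency spaces vanish.
-/

open Complex

open scoped InnerProductSpace

namespace LinearPMap

/-! ### Symmetric operators and the basic criterion -/

section Symmetric

variable {H : Type*} [NormedAddCommGroup H] [InnerProductSpace ℂ H]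

/-- The operator `T + i c` on the domain of `T`. -/
def addImag (T : H →ₗ.[ℂ] H) (c : ℝ) : T.domain →ₗ[ℂ] H :=
  T.toFun + ((c : ℂ) * I) • T.domain.subtype

theorem addImag_apply (T : H →ₗ.[ℂ] H) (c : ℝ) (x : T.domain) :
    T.addImag c x = T x + ((c : ℂ) * I) • (x : H) := rfl

/-- The cross term vanishes because `⟪T x, x⟫` is real. All later bounds on `T + i c` come from this
identity. -/
theorem norm_addImag_sq {T : H →ₗ.[ℂ] H} (hT : T.IsFormalAdjoint T) (c : ℝ) (x : T.domain) :
    ‖T.addImag c x‖ ^ 2 = ‖T x‖ ^ 2 + c ^ 2 * ‖(x : H)‖ ^ 2 := by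
  have hreal : (⟪T x, (x : H)⟫_ℂ).im = 0 := by
    rw [← Complex.conj_eq_iff_im, inner_conj_symm, hT x x]
  rw [addImag_apply, @norm_add_sq ℂ, inner_smul_right, norm_smul, mul_pow]
  simp [hreal]

theorem norm_le_norm_addImag {T : H →ₗ.[ℂ] H} (hT : T.IsFormalAdjoint T) (c : ℝ) (x : T.domain) :
    ‖T x‖ ≤ ‖T.addImag c x‖ := by
  refine le_of_sq_le_sq ?_ (norm_nonneg _)
  rw [norm_addImag_sq hT]
  nlinarith [mul_nonneg (sq_nonneg c) (sq_nonneg ‖(x : H)‖)]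

theorem abs_mul_norm_le_norm_addImag {T : H →ₗ.[ℂ] H} (hT : T.IsFormalAdjoint T) (c : ℝ)
    (x : T.domain) : |c| * ‖(x : H)‖ ≤ ‖T.addImag c x‖ := by
  refine le_of_sq_le_sq ?_ (norm_nonneg _)
  rw [norm_addImag_sq hT, mul_pow, sq_abs]
  nlinarith [sq_nonneg ‖T x‖]

theorem addImag_injective {T : H →ₗ.[ℂ] H} (hT : T.IsFormalAdjoint T) {c : ℝ} (hc : c ≠ 0) :
    Function.Injective (T.addImag c) := by
  refine (injective_iff_map_eq_zero _).2 fun x hx => ?_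
  have h := abs_mul_norm_le_norm_addImag hT c x
  rw [hx, norm_zero] at h
  have : ‖(x : H)‖ = 0 := by
    nlinarith [norm_nonneg (x : H), abs_pos.2 hc]
  exact Subtype.ext (norm_eq_zero.1 this)

/-- Symmetry is a closed condition on pairs of points of the graph, so it passes to the closure of
the graph. -/
theorem IsFormalAdjoint.closure {T : H →ₗ.[ℂ] H} (hT : T.IsFormalAdjoint T)
    (hcl : T.IsClosable) : T.closure.IsFormalAdjoint T.closure := by
  have key : ∀ p ∈ T.graph.topologicalClosure, ∀ q ∈ T.graph.topologicalClosure,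
      ⟪p.2, q.1⟫_ℂ = ⟪p.1, q.2⟫_ℂ := by
    intro p hp q hq
    have hpq : (p, q) ∈ _root_.closure ((T.graph : Set (H × H)) ×ˢ (T.graph : Set (H × H))) := by
      rw [closure_prod_eq]
      exact ⟨hp, hq⟩
    have hC : _root_.IsClosed {r : (H × H) × (H × H) | ⟪r.1.2, r.2.1⟫_ℂ = ⟪r.1.1, r.2.2⟫_ℂ} :=
      isClosed_eq (by fun_prop) (by fun_prop)
    refine closure_minimal ?_ hC hpq
    rintro ⟨⟨x, x'⟩, ⟨y, y'⟩⟩ ⟨hx, hy⟩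
    obtain ⟨u, rfl, rfl⟩ := (T.mem_graph_iff).1 hx
    obtain ⟨v, rfl, rfl⟩ := (T.mem_graph_iff).1 hy
    exact hT u v
  intro x y
  rw [hcl.graph_closure_eq_closure_graph] at key
  exact key _ (T.closure.mem_graph x) _ (T.closure.mem_graph y)

variable [CompleteSpace H]

/-- Viewed on the graph, which is complete, `T + i c` is a bounded map that controls both
coordinates of a graph point; it is therefore bounded below. -/
theorem isClosed_range_addImag {T : H →ₗ.[ℂ] H} (hT : T.IsFormalAdjoint T) (hcl : T.IsClosed)
    {c : ℝ} (hc : c ≠ 0) : _root_.IsClosed (Set.range (T.addImag c)) := by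
  let φ : T.graph →L[ℂ] H :=
    (ContinuousLinearMap.snd ℂ H H + ((c : ℂ) * I) • ContinuousLinearMap.fst ℂ H H).comp
      T.graph.subtypeL
  have hφ : ∀ x : T.domain, φ ⟨(x, T x), T.mem_graph x⟩ = T.addImag c x := fun x => rfl
  have : CompleteSpace T.graph := hcl.completeSpace_coe
  have hc' : 0 < |c| := abs_pos.2 hc
  have hanti : AntilipschitzWith (1 + |c|⁻¹).toNNReal φ := by
    refine ContinuousLinearMap.antilipschitz_of_bound φ ?_
    rintro ⟨⟨x, y⟩, hxy⟩
    obtain ⟨z, rfl, rfl⟩ := (T.mem_graph_iff).1 hxy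
    rw [hφ, Real.coe_toNNReal _ (by positivity)]
    refine max_le ?_ ?_
    · have h := abs_mul_norm_le_norm_addImag hT c z
      have h2 : ‖(z : H)‖ ≤ |c|⁻¹ * ‖T.addImag c z‖ := by
        rw [inv_mul_eq_div, le_div_iff₀ hc', mul_comm]; exact h
      calc ‖(z : H)‖ ≤ |c|⁻¹ * ‖T.addImag c z‖ := h2
        _ ≤ _ := by gcongr; linarith
    · calc ‖T z‖ ≤ 1 * ‖T.addImag c z‖ := by rw [one_mul]; exact norm_le_norm_addImag hT c z
        _ ≤ _ := by gcongr; linarith [inv_pos.2 hc']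
  have hrange : Set.range (T.addImag c) = Set.range φ := by
    ext h
    constructor
    · rintro ⟨x, rfl⟩
      exact ⟨_, hφ x⟩
    · rintro ⟨⟨⟨x, y⟩, hxy⟩, rfl⟩
      obtain ⟨z, rfl, rfl⟩ := (T.mem_graph_iff).1 hxy
      exact ⟨z, (hφ z).symm⟩
  rw [hrange]
  exact hanti.isClosed_range φ.uniformContinuous

theorem addImag_surjective {T : H →ₗ.[ℂ] H} (hT : T.IsFormalAdjoint T) (hcl : T.IsClosed)
    {c : ℝ} (hc : c ≠ 0) (h0 : ∀ h : H, (∀ x, ⟪h, T.addImag c x⟫_ℂ = 0) → h = 0) :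
    Function.Surjective (T.addImag c) := by
  rw [← LinearMap.range_eq_top]
  have hclosed : _root_.IsClosed (LinearMap.range (T.addImag c) : Set H) := by
    rw [LinearMap.coe_range]
    exact isClosed_range_addImag hT hcl hc
  rw [← hclosed.submodule_topologicalClosure_eq, Submodule.topologicalClosure_eq_top_iff,
    Submodule.eq_bot_iff]
  exact fun h hh => h0 h fun x => (Submodule.mem_orthogonal' _ _).1 hh _ ⟨x, rfl⟩

/-- A densely defined symmetric operator whose domain contains the domain of its adjoint is
self-adjoint. -/
theorem isSelfAdjoint_of_adjoint_domain_le {T : H →ₗ.[ℂ] H} (hd : Dense (T.domain : Set H))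
    (hT : T.IsFormalAdjoint T) (h : T.adjoint.domain ≤ T.domain) : IsSelfAdjoint T :=
  have hle : T ≤ T.adjoint := hT.le_adjoint hd
  (eq_of_le_of_domain_eq hle (le_antisymm hle.1 h)).symm

theorem _root_.IsSelfAdjoint.isFormalAdjoint {T : H →ₗ.[ℂ] H} (hT : IsSelfAdjoint T) :
    T.IsFormalAdjoint T := by
  have h := adjoint_isFormalAdjoint hT.dense_domain
  rwa [isSelfAdjoint_def.1 hT] at h

/-- If `h` is orthogonal to the range of `T + i c`, then `h` lies in the kernel of `T† - i c`. -/
theorem exists_adjoint_eq_of_orthogonal {T : H →ₗ.[ℂ] H} (hd : Dense (T.domain : Set H)) {c : ℝ}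
    {h : H} (hh : ∀ x, ⟪h, T.addImag c x⟫_ℂ = 0) :
    ∃ hm : h ∈ T.adjoint.domain, T.adjoint ⟨h, hm⟩ = ((c : ℂ) * I) • h := by
  have key : ∀ x : T.domain, ⟪((c : ℂ) * I) • h, (x : H)⟫_ℂ = ⟪h, T x⟫_ℂ := fun x => by
    have := hh x
    rw [addImag_apply, inner_add_right, inner_smul_right] at this
    rw [inner_smul_left, eq_neg_of_add_eq_zero_left this]
    simp
  exact ⟨mem_adjoint_domain_of_exists h ⟨_, key⟩, adjoint_apply_eq hd _ key⟩

theorem _root_.IsSelfAdjoint.addImag_surjective {T : H →ₗ.[ℂ] H} (hT : IsSelfAdjoint T) {c : ℝ}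
    (hc : c ≠ 0) : Function.Surjective (T.addImag c) := by
  refine LinearPMap.addImag_surjective hT.isFormalAdjoint hT.isClosed hc fun h hh => ?_
  obtain ⟨hm, he⟩ := exists_adjoint_eq_of_orthogonal hT.dense_domain hh
  have hle : T.adjoint ≤ T := (isSelfAdjoint_def.1 hT).le
  -- Here `T† = T`, so `h` is an eigenvector of the symmetric `T` for the non-real value `i c`.
  have h0 : T.addImag (-c) ⟨h, hle.1 hm⟩ = 0 := by
    rw [addImag_apply, ← hle.2 (x := ⟨h, hm⟩) rfl, he]
    simp
  exact congrArg Subtype.val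
    ((map_eq_zero_iff _ (addImag_injective hT.isFormalAdjoint (neg_ne_zero.2 hc))).1 h0)

theorem isFormalAdjoint_of_le_adjoint {T : H →ₗ.[ℂ] H} (hd : Dense (T.domain : Set H))
    (h : T ≤ T.adjoint) : T.IsFormalAdjoint T := fun x y => by
  rw [h.2 (x := x) (y := ⟨x, h.1 x.2⟩) rfl]
  exact adjoint_isFormalAdjoint hd _ y

/-- The basic criterion for essential self-adjointness: the deficiency spaces of a densely defined
symmetric operator are trivial. -/
theorem isEssentiallySelfAdjoint_of_orthogonal {T : H →ₗ.[ℂ] H} (hd : Dense (T.domain : Set H))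
    (hT : T.IsFormalAdjoint T) {c : ℝ} (hc : c ≠ 0)
    (hpos : ∀ h : H, (∀ x, ⟪h, T.addImag c x⟫_ℂ = 0) → h = 0)
    (hneg : ∀ h : H, (∀ x, ⟪h, T.addImag (-c) x⟫_ℂ = 0) → h = 0) :
    IsEssentiallySelfAdjoint T := by
  have hcl : T.IsClosable := (adjoint_isClosed hd).isClosable.leIsClosable (hT.le_adjoint hd)
  have hle := T.le_closure
  have hN := hT.closure hcl
  have hdN : Dense (T.closure.domain : Set H) := hd.mono hle.1
  have hlift : ∀ (d : ℝ), (∀ h : H, (∀ x, ⟪h, T.addImag d x⟫_ℂ = 0) → h = 0) →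
      ∀ h : H, (∀ x, ⟪h, T.closure.addImag d x⟫_ℂ = 0) → h = 0 := fun d hTd h hh =>
    hTd h fun x => by
      have := hh (Submodule.inclusion hle.1 x)
      rwa [addImag_apply, ← apply_comp_inclusion hle x] at this
  refine ⟨hd, hcl, isSelfAdjoint_of_adjoint_domain_le hdN hN fun y hy => ?_⟩
  -- With `N` the closure, solve `(N + i c) x = (N† + i c) y`; then `y - x` is orthogonal to the
  -- range of `N - i c`, hence zero.
  obtain ⟨x, hx⟩ := addImag_surjective hN hcl.closure_isClosed hc (hlift c hpos)
    (T.closure.adjoint ⟨y, hy⟩ + ((c : ℂ) * I) • y)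
  have hyx : y - x = 0 := by
    refine hlift (-c) hneg _ fun z => ?_
    have h1 : ⟪T.closure.adjoint ⟨y, hy⟩, (z : H)⟫_ℂ = ⟪y, T.closure z⟫_ℂ :=
      adjoint_isFormalAdjoint hdN ⟨y, hy⟩ z
    have h2 := hN x z
    have h3 := congrArg (fun w => ⟪w, (z : H)⟫_ℂ) hx
    simp only [addImag_apply, inner_add_left, inner_smul_left, h1, h2] at h3
    simp only [addImag_apply, inner_add_right, inner_smul_right, inner_sub_left]
    simp only [map_mul, Complex.conj_ofReal, Complex.conj_I] at h3
    push_cast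
    linear_combination -h3
  rw [sub_eq_zero.1 hyx]
  exact x.2

end Symmetric

/-! ### Wüst's theorem -/

section Wust

variable {H : Type*} [NormedAddCommGroup H] [InnerProductSpace ℂ H] [CompleteSpace H]

/-- If `V` is bounded relative to `S + i c` with bound `1` and `0 ≤ t < 1`, then `S + t V + i c` is
onto. -/
theorem exists_addImag_add_smul_eq {S : H →ₗ.[ℂ] H} (hS : IsSelfAdjoint S) {c : ℝ} (hc : c ≠ 0)
    (V : S.domain →ₗ[ℂ] H) (hV : ∀ x, ‖V x‖ ≤ ‖S.addImag c x‖) {t : ℝ} (ht0 : 0 ≤ t) (ht1 : t < 1)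
    (h : H) : ∃ u : S.domain, S.addImag c u + (t : ℂ) • V u = h := by
  let e := LinearEquiv.ofBijective (S.addImag c)
    ⟨addImag_injective hS.isFormalAdjoint hc, hS.addImag_surjective hc⟩
  -- `K = -t V (S + i c)⁻¹`, so `1 - K = (S + t V + i c) (S + i c)⁻¹`.
  let K : H →L[ℂ] H := (-(t : ℂ) • (V ∘ₗ e.symm.toLinearMap)).mkContinuous t fun y => by
    have h1 := hV (e.symm y)
    have h2 : S.addImag c (e.symm y) = y := e.apply_symm_apply y
    rw [h2] at h1
    simpa [norm_smul, abs_of_nonneg ht0] using mul_le_mul_of_nonneg_left h1 ht0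
  have hK : ‖K‖ < 1 := (LinearMap.mkContinuous_norm_le _ ht0 _).trans_lt ht1
  obtain ⟨w, hw⟩ := isUnit_one_sub_of_norm_lt_one hK
  let y := (↑w⁻¹ : H →L[ℂ] H) h
  have hy : y - K y = h := by
    have : (w : H →L[ℂ] H) ((↑w⁻¹ : H →L[ℂ] H) h) = h := by
      rw [← mul_apply_eq_comp, Units.mul_inv, one_apply_eq_self]
    rwa [hw] at this
  refine ⟨e.symm y, ?_⟩
  have h2 : S.addImag c (e.symm y) = y := e.apply_symm_apply y
  rw [h2]
  have hKy : K y = -(t : ℂ) • V (e.symm y) := rfl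
  rw [← hy, hKy, neg_smul, sub_neg_eq_add]

/-- The range of `S + V + i c` is dense if `V` is symmetric and bounded relative to `S + i c` with
bound `1`. -/
theorem eq_zero_of_orthogonal_addImag_add {S : H →ₗ.[ℂ] H} (hS : IsSelfAdjoint S) {c : ℝ}
    (hc : c ≠ 0) (V : S.domain →ₗ[ℂ] H) (hV : ∀ x, ‖V x‖ ≤ ‖S.addImag c x‖)
    (hsymm : ∀ x y : S.domain, ⟪V x, (y : H)⟫_ℂ = ⟪(x : H), V y⟫_ℂ) {h : H}
    (hh : ∀ x, ⟪h, S.addImag c x + V x⟫_ℂ = 0) : h = 0 := by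
  have hc' : 0 < |c| := abs_pos.2 hc
  by_contra hne
  have hpos : 0 < ‖h‖ := norm_pos_iff.2 hne
  -- Although `(1 - t) V u` is only bounded as `t → 1`, its inner product with a fixed `g` in the
  -- domain is `(1 - t) ⟪V g, u⟫`, which tends to `0`.
  have key : ∀ (g : S.domain) (t : ℝ), 0 ≤ t → t < 1 →
      ‖h‖ ≤ ‖h - g‖ + (1 - t) * (‖V g‖ / |c|) := by
    intro g t ht0 ht1
    obtain ⟨u, hu⟩ := exists_addImag_add_smul_eq hS hc V hV ht0 ht1 h
    have hnt : ‖(t : ℂ)‖ = t := by simp [abs_of_nonneg ht0]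
    have hnt' : ‖((1 - t : ℝ) : ℂ)‖ = 1 - t := by
      rw [Complex.norm_real, Real.norm_of_nonneg (by linarith)]
    have hun : |c| * ‖(u : H)‖ ≤ ‖h‖ := by
      -- `S + t V` is itself symmetric, which bounds `u` uniformly in `t`.
      let P : H →ₗ.[ℂ] H := ⟨S.domain, S.toFun + (t : ℂ) • V⟩
      have hP : P.IsFormalAdjoint P := fun x y => by
        change ⟪S x + (t : ℂ) • V x, (y : H)⟫_ℂ = ⟪(x : H), S y + (t : ℂ) • V y⟫_ℂ
        rw [inner_add_left, inner_add_right, inner_smul_left, inner_smul_right, hsymm x y,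
          hS.isFormalAdjoint x y, Complex.conj_ofReal]
      have := abs_mul_norm_le_norm_addImag hP c u
      have hPu : P.addImag c u = h := by
        rw [← hu]
        change S u + (t : ℂ) • V u + ((c : ℂ) * I) • (u : H) = _
        rw [addImag_apply]
        abel
      rwa [hPu] at this
    have hwn : (1 - t) * ‖V u‖ ≤ ‖h‖ := by
      have h1 : ‖S.addImag c u‖ ≤ ‖h‖ + t * ‖V u‖ := by
        rw [eq_sub_of_add_eq hu]
        refine (norm_sub_le _ _).trans_eq ?_
        rw [norm_smul, hnt]
      linarith [hV u]
    have hsplit : S.addImag c u + V u = h + ((1 - t : ℝ) : ℂ) • V u := by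
      rw [← hu]
      push_cast
      module
    have horth := hh u
    rw [hsplit, inner_add_right, inner_self_eq_norm_sq_to_K] at horth
    have hsq : ‖h‖ ^ 2 = ‖⟪h, ((1 - t : ℝ) : ℂ) • V u⟫_ℂ‖ := by
      rw [← norm_neg ⟪h, _⟫_ℂ, ← eq_neg_of_add_eq_zero_left horth]
      simp
    have hdec : ⟪h, ((1 - t : ℝ) : ℂ) • V u⟫_ℂ =
        ⟪h - g, ((1 - t : ℝ) : ℂ) • V u⟫_ℂ + ((1 - t : ℝ) : ℂ) * ⟪V g, (u : H)⟫_ℂ := by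
      rw [hsymm, inner_sub_left, inner_smul_right (g : H)]
      ring
    have hb1 : ‖⟪h - g, ((1 - t : ℝ) : ℂ) • V u⟫_ℂ‖ ≤ ‖h - g‖ * ‖h‖ := by
      refine (norm_inner_le_norm _ _).trans ?_
      rw [norm_smul, hnt']
      gcongr
    have hb2 : ‖((1 - t : ℝ) : ℂ) * ⟪V g, (u : H)⟫_ℂ‖ ≤ (1 - t) * (‖V g‖ / |c|) * ‖h‖ := by
      rw [norm_mul, hnt', mul_assoc]
      refine mul_le_mul_of_nonneg_left ((norm_inner_le_norm _ _).trans ?_) (by linarith)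
      rw [div_mul_eq_mul_div, mul_div_assoc]
      gcongr
      rw [le_div_iff₀ hc', mul_comm]
      exact hun
    refine le_of_mul_le_mul_right ?_ hpos
    calc ‖h‖ * ‖h‖ = ‖⟪h, ((1 - t : ℝ) : ℂ) • V u⟫_ℂ‖ := by rw [← hsq, sq]
      _ ≤ ‖h - g‖ * ‖h‖ + (1 - t) * (‖V g‖ / |c|) * ‖h‖ := by
        rw [hdec]
        exact (norm_add_le _ _).trans (add_le_add hb1 hb2)
      _ = _ := by ring
  have key2 : ∀ g : S.domain, ‖h‖ ≤ ‖h - g‖ := by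
    intro g
    have hlim : Filter.Tendsto (fun t : ℝ => ‖h - g‖ + (1 - t) * (‖V g‖ / |c|))
        (nhdsWithin 1 (Set.Iio 1)) (nhds (‖h - g‖ + (1 - 1) * (‖V g‖ / |c|))) :=
      (Continuous.tendsto (by fun_prop) 1).mono_left nhdsWithin_le_nhds
    rw [sub_self, zero_mul, add_zero] at hlim
    refine ge_of_tendsto hlim ?_
    filter_upwards [Ioo_mem_nhdsLT (zero_lt_one' ℝ)] with t ht
    exact key g t ht.1.le ht.2
  -- By density some `g` in the domain is closer to `h` than `‖h‖`.
  obtain ⟨g, hg, hlt⟩ := Metric.dense_iff.1 hS.dense_domain h ‖h‖ hpos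
  rw [Metric.mem_ball, dist_comm, dist_eq_norm] at hg
  exact absurd hg (not_lt.2 (key2 ⟨g, hlt⟩))

/-- **Wüst's theorem** for relative bounds in square form: a symmetric perturbation of a
self-adjoint operator with relative bound `1` is essentially self-adjoint. -/
theorem _root_.IsSelfAdjoint.isEssentiallySelfAdjoint_add {S T : H →ₗ.[ℂ] H}
    (hS : IsSelfAdjoint S) (hT : T.IsFormalAdjoint T) {a : ℝ} (hb : SqRelBounded T S a) :
    IsEssentiallySelfAdjoint (S + T) := by
  obtain ⟨hle, hbound⟩ := hb
  let V : S.domain →ₗ[ℂ] H := T.toFun ∘ₗ Submodule.inclusion hle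
  have hsymm : ∀ x y : S.domain, ⟪V x, (y : H)⟫_ℂ = ⟪(x : H), V y⟫_ℂ := fun x y =>
    hT (Submodule.inclusion hle x) (Submodule.inclusion hle y)
  have hdom : (S + T).domain = S.domain := inf_eq_left.2 hle
  have hsum : ∀ (d : ℝ) (x : S.domain),
      (S + T).addImag d ⟨x, hdom.ge x.2⟩ = S.addImag d x + V x := fun d x => by
    change S x + V x + ((d : ℂ) * I) • (x : H) = _
    rw [addImag_apply]
    abel
  have hV : ∀ d : ℝ, a ≤ d ^ 2 → ∀ x, ‖V x‖ ≤ ‖S.addImag d x‖ := fun d hd x => by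
    refine le_of_sq_le_sq ?_ (norm_nonneg _)
    rw [norm_addImag_sq hS.isFormalAdjoint]
    have h1 : ‖V x‖ ^ 2 ≤ a * ‖(x : H)‖ ^ 2 + ‖S x‖ ^ 2 := hbound x
    nlinarith [mul_le_mul_of_nonneg_right hd (sq_nonneg ‖(x : H)‖)]
  -- The choice `c = 1 + |a|` gives `c ≠ 0` and `a ≤ c ^ 2`.
  have hac : a ≤ (1 + |a|) ^ 2 := by nlinarith [le_abs_self a, abs_nonneg a]
  have hc : (1 + |a|) ≠ 0 := by positivity
  have hformal : (S + T).IsFormalAdjoint (S + T) := fun x y => by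
    rw [add_apply, add_apply, inner_add_left, inner_add_right]
    exact congrArg₂ _ (hS.isFormalAdjoint ⟨x, x.2.1⟩ ⟨y, y.2.1⟩) (hT ⟨x, x.2.2⟩ ⟨y, y.2.2⟩)
  refine isEssentiallySelfAdjoint_of_orthogonal (hdom ▸ hS.dense_domain) hformal hc
    (fun h hh => ?_) fun h hh => ?_
  · refine eq_zero_of_orthogonal_addImag_add hS hc V (hV _ hac) hsymm fun x => ?_
    rw [← hsum]
    exact hh _
  · refine eq_zero_of_orthogonal_addImag_add hS (neg_ne_zero.2 hc) V
      (hV _ (by rwa [neg_sq])) hsymm fun x => ?_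
    rw [← hsum]
    exact hh _

end Wust

/-! ### Double adjoint of a closed operator -/

section DoubleAdjoint

variable {E F : Type*} [NormedAddCommGroup E] [InnerProductSpace ℂ E] [CompleteSpace E]
  [NormedAddCommGroup F] [InnerProductSpace ℂ F] [CompleteSpace F]

/-- A closed graph is its own double orthogonal complement in the Hilbert sum, and vectors
orthogonal to it have the form `(-T† q, q)`. The graph of `T††` is orthogonal to all of these. -/
theorem IsClosed.adjoint_adjoint_domain_le {T : E →ₗ.[ℂ] F} (hcl : T.IsClosed)
    (hd : Dense (T.domain : Set E)) (hd' : Dense (T.adjoint.domain : Set F)) :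
    T.adjoint.adjoint.domain ≤ T.domain := by
  intro y hy
  let G : Submodule ℂ (WithLp 2 (E × F)) :=
    T.graph.comap (WithLp.linearEquiv 2 ℂ (E × F)).toLinearMap
  have hG : _root_.IsClosed (G : Set (WithLp 2 (E × F))) :=
    hcl.preimage (WithLp.prod_continuous_ofLp 2 E F)
  have hmem : WithLp.toLp 2 (y, T.adjoint.adjoint ⟨y, hy⟩) ∈ G := by
    rw [← hG.submodule_topologicalClosure_eq, ← Submodule.orthogonal_orthogonal_eq_closure,
      Submodule.mem_orthogonal]
    intro p hp
    have hp' : ∀ x : T.domain, ⟪-p.fst, (x : E)⟫_ℂ = ⟪p.snd, T x⟫_ℂ := fun x => by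
      have := (Submodule.mem_orthogonal' _ _).1 hp (WithLp.toLp 2 ((x : E), T x)) (T.mem_graph x)
      rw [WithLp.prod_inner_apply] at this
      rw [inner_neg_left]
      exact (eq_neg_of_add_eq_zero_right this).symm
    have hq : p.snd ∈ T.adjoint.domain := mem_adjoint_domain_of_exists _ ⟨_, hp'⟩
    have hTq : T.adjoint ⟨p.snd, hq⟩ = -p.fst := adjoint_apply_eq hd _ hp'
    have h1 := (adjoint_isFormalAdjoint hd').symm ⟨p.snd, hq⟩ ⟨y, hy⟩
    rw [hTq, inner_neg_left] at h1
    rw [WithLp.prod_inner_apply]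
    change ⟪p.fst, y⟫_ℂ + ⟪p.snd, T.adjoint.adjoint ⟨y, hy⟩⟫_ℂ = 0
    rw [← h1]
    exact add_neg_cancel _
  obtain ⟨z, hz, -⟩ := (T.mem_graph_iff).1 hmem
  have : (z : E) = y := hz
  exact this ▸ z.2

end DoubleAdjoint

end LinearPMap

/-! ### Diagonal and off-diagonal block operators -/

section Block

open LinearPMap

theorem WithLp.dense_of_forall_mem_iff {X Y : Type*} [TopologicalSpace X] [TopologicalSpace Y]
    {s : Set X} {t : Set Y} {u : Set (WithLp 2 (X × Y))}
    (hs : Dense s) (ht : Dense t) (h : ∀ z, z ∈ u ↔ z.fst ∈ s ∧ z.snd ∈ t) : Dense u := by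
  have hu : u = (WithLp.homeomorphProd 2 X Y) ⁻¹' (s ×ˢ t) := Set.ext h
  rw [hu]
  exact (hs.prod ht).preimage (WithLp.homeomorphProd 2 X Y).isOpenMap

variable {H₁ H₂ : Type*} [NormedAddCommGroup H₁] [InnerProductSpace ℂ H₁]
  [NormedAddCommGroup H₂] [InnerProductSpace ℂ H₂]
  {A : H₁ →ₗ.[ℂ] H₁} {B : H₂ →ₗ.[ℂ] H₁} {C : H₁ →ₗ.[ℂ] H₂} {D : H₂ →ₗ.[ℂ] H₂}

theorem blockOperator_apply (z : (blockOperator A B C D).domain) :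
    blockOperator A B C D z = WithLp.toLp 2
      (A ⟨z.1.fst, z.2.1.1⟩ + B ⟨z.1.snd, z.2.2.1⟩,
        C ⟨z.1.fst, z.2.1.2⟩ + D ⟨z.1.snd, z.2.2.2⟩) := rfl

theorem blockOperator_diagonal_apply (z : (blockOperator A 0 0 D).domain) :
    blockOperator A 0 0 D z =
      WithLp.toLp 2 (A ⟨z.1.fst, z.2.1.1⟩, D ⟨z.1.snd, z.2.2.2⟩) := by
  rw [blockOperator_apply, LinearPMap.zero_apply, LinearPMap.zero_apply, add_zero, zero_add]

theorem blockOperator_offDiagonal_apply (z : (blockOperator 0 B C 0).domain) :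
    blockOperator 0 B C 0 z =
      WithLp.toLp 2 (B ⟨z.1.snd, z.2.2.1⟩, C ⟨z.1.fst, z.2.1.2⟩) := by
  rw [blockOperator_apply, LinearPMap.zero_apply, LinearPMap.zero_apply, add_zero, zero_add]

theorem mem_blockOperator_diagonal_domain {z : WithLp 2 (H₁ × H₂)} :
    z ∈ (blockOperator A 0 0 D).domain ↔ z.fst ∈ A.domain ∧ z.snd ∈ D.domain :=
  ⟨fun h => ⟨h.1.1, h.2.2⟩, fun h => ⟨⟨h.1, trivial⟩, ⟨trivial, h.2⟩⟩⟩

theorem mem_blockOperator_offDiagonal_domain {z : WithLp 2 (H₁ × H₂)} :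
    z ∈ (blockOperator 0 B C 0).domain ↔ z.fst ∈ C.domain ∧ z.snd ∈ B.domain :=
  ⟨fun h => ⟨h.1.2, h.2.1⟩, fun h => ⟨⟨trivial, h.1⟩, ⟨h.2, trivial⟩⟩⟩

theorem blockOperator_eq_diagonal_add_offDiagonal :
    blockOperator A B C D = blockOperator A 0 0 D + blockOperator 0 B C 0 := by
  refine LinearPMap.ext ?_ fun z hz hz' => ?_
  · ext z
    exact ⟨fun h => ⟨⟨⟨h.1.1, trivial⟩, ⟨trivial, h.2.2⟩⟩, ⟨⟨trivial, h.1.2⟩, ⟨h.2.1, trivial⟩⟩⟩,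
      fun h => ⟨⟨h.1.1.1, h.2.1.2⟩, ⟨h.2.2.1, h.1.2.2⟩⟩⟩
  · rw [LinearPMap.add_apply, blockOperator_diagonal_apply, blockOperator_offDiagonal_apply,
      blockOperator_apply, ← WithLp.toLp_add, Prod.mk_add_mk, add_comm (D _)]

theorem isFormalAdjoint_blockOperator_diagonal (hA : A.IsFormalAdjoint A)
    (hD : D.IsFormalAdjoint D) :
    (blockOperator A 0 0 D).IsFormalAdjoint (blockOperator A 0 0 D) := fun z w => by
  rw [blockOperator_diagonal_apply, blockOperator_diagonal_apply, WithLp.prod_inner_apply,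
    WithLp.prod_inner_apply]
  exact congrArg₂ _ (hA ⟨z.1.fst, z.2.1.1⟩ ⟨w.1.fst, w.2.1.1⟩)
    (hD ⟨z.1.snd, z.2.2.2⟩ ⟨w.1.snd, w.2.2.2⟩)

theorem isFormalAdjoint_blockOperator_offDiagonal (hBC : B.IsFormalAdjoint C) :
    (blockOperator 0 B C 0).IsFormalAdjoint (blockOperator 0 B C 0) := fun z w => by
  rw [blockOperator_offDiagonal_apply, blockOperator_offDiagonal_apply, WithLp.prod_inner_apply,
    WithLp.prod_inner_apply]
  exact (congrArg₂ _ (hBC ⟨z.1.snd, z.2.2.1⟩ ⟨w.1.fst, w.2.1.2⟩)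
    (hBC.symm ⟨z.1.fst, z.2.1.2⟩ ⟨w.1.snd, w.2.2.1⟩)).trans (add_comm _ _)

theorem sqRelBounded_offDiagonal_diagonal {a : ℝ} (hC : SqRelBounded C A a)
    (hB : SqRelBounded B D a) :
    SqRelBounded (blockOperator 0 B C 0) (blockOperator A 0 0 D) a := by
  obtain ⟨hAC, hC⟩ := hC
  obtain ⟨hDB, hB⟩ := hB
  refine ⟨fun z hz => ⟨⟨trivial, hAC hz.1.1⟩, ⟨hDB hz.2.2, trivial⟩⟩, fun z => ?_⟩
  rw [blockOperator_offDiagonal_apply, blockOperator_diagonal_apply, WithLp.prod_norm_sq_eq_of_L2,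
    WithLp.prod_norm_sq_eq_of_L2, WithLp.prod_norm_sq_eq_of_L2]
  have h1 := hC ⟨z.1.fst, z.2.1.1⟩
  have h2 := hB ⟨z.1.snd, z.2.2.2⟩
  refine (add_comm _ _).trans_le ((add_le_add h1 h2).trans_eq ?_)
  simp only [WithLp.toLp_fst, WithLp.toLp_snd]
  ring

theorem sqRelBounded_diagonal_offDiagonal {a : ℝ} (hA : SqRelBounded A C a)
    (hD : SqRelBounded D B a) :
    SqRelBounded (blockOperator A 0 0 D) (blockOperator 0 B C 0) a := by
  obtain ⟨hCA, hA⟩ := hA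
  obtain ⟨hBD, hD⟩ := hD
  refine ⟨fun z hz => ⟨⟨hCA hz.1.2, trivial⟩, ⟨trivial, hBD hz.2.1⟩⟩, fun z => ?_⟩
  rw [blockOperator_offDiagonal_apply, blockOperator_diagonal_apply, WithLp.prod_norm_sq_eq_of_L2,
    WithLp.prod_norm_sq_eq_of_L2, WithLp.prod_norm_sq_eq_of_L2]
  have h1 := hA ⟨z.1.fst, z.2.1.2⟩
  have h2 := hD ⟨z.1.snd, z.2.2.1⟩
  refine (add_le_add h1 h2).trans_eq ?_
  simp only [WithLp.toLp_fst, WithLp.toLp_snd]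
  ring

variable [CompleteSpace H₁] [CompleteSpace H₂]

/-- Testing the adjoint on vectors with one zero component puts each component of `y` in the domain
of `A†` or `D†`. -/
theorem isSelfAdjoint_blockOperator_diagonal (hA : IsSelfAdjoint A) (hD : IsSelfAdjoint D) :
    IsSelfAdjoint (blockOperator A 0 0 D) := by
  have hd : Dense ((blockOperator A 0 0 D).domain : Set (WithLp 2 (H₁ × H₂))) :=
    WithLp.dense_of_forall_mem_iff hA.dense_domain hD.dense_domain
      fun _ => mem_blockOperator_diagonal_domain
  refine isSelfAdjoint_of_adjoint_domain_le hd
    (isFormalAdjoint_blockOperator_diagonal hA.isFormalAdjoint hD.isFormalAdjoint) fun y hy => ?_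
  have key := adjoint_isFormalAdjoint hd ⟨y, hy⟩
  set w := (blockOperator A 0 0 D).adjoint ⟨y, hy⟩
  rw [mem_blockOperator_diagonal_domain]
  constructor
  · rw [← isSelfAdjoint_def.1 hA]
    refine mem_adjoint_domain_of_exists _ ⟨w.fst, fun x => ?_⟩
    have h := key ⟨WithLp.toLp 2 ((x : H₁), 0),
      mem_blockOperator_diagonal_domain.2 ⟨x.2, D.domain.zero_mem⟩⟩
    rw [blockOperator_diagonal_apply, WithLp.prod_inner_apply, WithLp.prod_inner_apply] at h
    have h0 : D ⟨0, D.domain.zero_mem⟩ = 0 := D.map_zero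
    simpa [h0] using h
  · rw [← isSelfAdjoint_def.1 hD]
    refine mem_adjoint_domain_of_exists _ ⟨w.snd, fun x => ?_⟩
    have h := key ⟨WithLp.toLp 2 (0, (x : H₂)),
      mem_blockOperator_diagonal_domain.2 ⟨A.domain.zero_mem, x.2⟩⟩
    rw [blockOperator_diagonal_apply, WithLp.prod_inner_apply, WithLp.prod_inner_apply] at h
    have h0 : A ⟨0, A.domain.zero_mem⟩ = 0 := A.map_zero
    simpa [h0] using h

/-- The same test vectors place the components in the domains of `B†` and `B††`; closedness of `B`
brings the latter back to the domain of `B`. -/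
theorem isSelfAdjoint_blockOperator_offDiagonal (hB : B.IsClosed)
    (hB_dense : Dense (B.domain : Set H₂)) (hB_dense' : Dense (B.adjoint.domain : Set H₁)) :
    IsSelfAdjoint (blockOperator 0 B B.adjoint 0) := by
  have hd : Dense ((blockOperator 0 B B.adjoint 0).domain : Set (WithLp 2 (H₁ × H₂))) :=
    WithLp.dense_of_forall_mem_iff hB_dense' hB_dense fun _ => mem_blockOperator_offDiagonal_domain
  refine isSelfAdjoint_of_adjoint_domain_le hd
    (isFormalAdjoint_blockOperator_offDiagonal (adjoint_isFormalAdjoint hB_dense).symm)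
    fun y hy => ?_
  have key := adjoint_isFormalAdjoint hd ⟨y, hy⟩
  set w := (blockOperator 0 B B.adjoint 0).adjoint ⟨y, hy⟩
  rw [mem_blockOperator_offDiagonal_domain]
  constructor
  · refine mem_adjoint_domain_of_exists _ ⟨w.snd, fun x => ?_⟩
    have h := key ⟨WithLp.toLp 2 (0, (x : H₂)),
      mem_blockOperator_offDiagonal_domain.2 ⟨B.adjoint.domain.zero_mem, x.2⟩⟩
    rw [blockOperator_offDiagonal_apply, WithLp.prod_inner_apply, WithLp.prod_inner_apply] at h
    have h0 : B.adjoint ⟨0, B.adjoint.domain.zero_mem⟩ = 0 := B.adjoint.map_zero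
    simpa [h0] using h
  · refine hB.adjoint_adjoint_domain_le hB_dense hB_dense'
      (mem_adjoint_domain_of_exists _ ⟨w.fst, fun x => ?_⟩)
    have h := key ⟨WithLp.toLp 2 ((x : H₁), 0),
      mem_blockOperator_offDiagonal_domain.2 ⟨x.2, B.domain.zero_mem⟩⟩
    rw [blockOperator_offDiagonal_apply, WithLp.prod_inner_apply, WithLp.prod_inner_apply] at h
    have h0 : B ⟨0, B.domain.zero_mem⟩ = 0 := B.map_zero
    simpa [h0] using h

end Block

theorem mainTheorem7 {H₁ H₂ : Type*}
    [NormedAddCommGroup H₁] [InnerProductSpace ℂ H₁] [CompleteSpace H₁]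
    [NormedAddCommGroup H₂] [InnerProductSpace ℂ H₂] [CompleteSpace H₂]
    (A : H₁ →ₗ.[ℂ] H₁) (B : H₂ →ₗ.[ℂ] H₁) (C : H₁ →ₗ.[ℂ] H₂) (D : H₂ →ₗ.[ℂ] H₂)
    (hA_dense : Dense (A.domain : Set H₁)) (hB_dense : Dense (B.domain : Set H₂))
    (hC_dense : Dense (C.domain : Set H₁)) (hD_dense : Dense (D.domain : Set H₂))
    (hA_closable : A.IsClosable) (hB_closable : B.IsClosable)
    (hC_closable : C.IsClosable) (hD_closable : D.IsClosable)
    (hA_symm : A ≤ A.adjoint) (hBC : B ≤ C.adjoint) (hD_symm : D ≤ D.adjoint)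
    (h_dense : Dense ((blockOperator A B C D).domain : Set (WithLp 2 (H₁ × H₂)))) :
    ((IsSelfAdjoint A ∧ IsSelfAdjoint D ∧
        ∃ a : ℝ, 0 ≤ a ∧ SqRelBounded C A a ∧ SqRelBounded B D a) →
      IsEssentiallySelfAdjoint (blockOperator A B C D)) ∧
    ((B.IsClosed ∧ C = B.adjoint ∧
        ∃ a : ℝ, 0 ≤ a ∧ SqRelBounded A C a ∧ SqRelBounded D B a) →
      IsEssentiallySelfAdjoint (blockOperator A B C D)) := by
  rw [blockOperator_eq_diagonal_add_offDiagonal]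
  constructor
  · rintro ⟨hA, hD, a, -, hC, hB⟩
    refine (isSelfAdjoint_blockOperator_diagonal hA hD).isEssentiallySelfAdjoint_add
      (isFormalAdjoint_blockOperator_offDiagonal fun y x => ?_)
      (sqRelBounded_offDiagonal_diagonal hC hB)
    rw [hBC.2 (x := y) (y := ⟨y, hBC.1 y.2⟩) rfl]
    exact LinearPMap.adjoint_isFormalAdjoint hC_dense _ x
  -- After substituting `C = B†`, `hC_dense` is the density of the domain of `B†`.
  · rintro ⟨hB, rfl, a, -, hA, hD⟩
    rw [add_comm]
    exact (isSelfAdjoint_blockOperator_offDiagonal hB hB_dense hC_dense).isEssentiallySelfAdjoint_add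
      (isFormalAdjoint_blockOperator_diagonal
        (LinearPMap.isFormalAdjoint_of_le_adjoint hA_dense hA_symm)
        (LinearPMap.isFormalAdjoint_of_le_adjoint hD_dense hD_symm))
      (sqRelBounded_diagonal_offDiagonal hA hD)
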